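/- Let $d>0$, and for each sample size $N$ let $p=p_N$ be $N^d$ rounded (up or down) to an integer. Consider the linear model $\mathbf y=\mathbf A\mathbf x+\mathbf e$ with a design matrix $\mathbf A=\mathbf A^{(N)}\in\mathbb R^{N\times p}$ and $\mathbf e\sim\mathcal N(\mathbf 0,\sigma^2\mathbf I_N)$, $\sigma^2=\sigma_N^2>0$. The coefficients $x_j$ do not depend on $N$; their support $\mathcal S=\{j: x_j\ne 0\}$ is finite, with $k_0$ elements, and $K$ is a constant with $K\ge k_0$. The SNR $\|\mathbf A\mathbf x\|_2^2/(N\sigma_N^2)$ is fixed or, more generally, converges as $N\to\infty$ to a limit, which is positive if $\mathbf x\neq\mathbf 0$ (this includes the case that $\sigma^2$ is fixed). For $\mathcal I\subseteq\{1,\dots,p\}$ with $k=\mathrm{card}(\mathcal I)$ let $\mathbf A_{\mathcal I}$ consist of the columns of $\mathbf A$ with index in $\mathcal I$, $\boldsymbol\Pi_{\mathcal I}=\mathbf A_{\mathcal I}(\mathbf A_{\mathcal I}^T\mathbf A_{\mathcal I})^{-1}\mathbf A_{\mathcal I}^T$, $\hat\sigma_{\mathcal I}^2=\mathbf y^T(\mathbf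 I_N-\boldsymbol\Pi_{\mathcal I})\mathbf y/N$, $\hat\sigma_0^2=\|\mathbf y\|_2^2/N$, and $$\mathrm{EBIC}_R(\mathcal I)=N\ln\hat\sigma_{\mathcal I}^2+k\ln\frac{N}{2\pi}+(k+2)\ln\frac{\hat\sigma_0^2}{\hat\sigma_{\mathcal I}^2}+2k\zeta\ln p .$$ Assume the sparse Riesz condition: for every fixed finite index set $\mathcal I$ with $\mathrm{card}(\mathcal I)\le 2K$, $N^{-1}\mathbf A_{\mathcal I}^T\mathbf A_{\mathcal I}$ converges as $N\to\infty$ to a positive definite matrix $\mathbf M_{\mathcal I}$; and, uniformly, there is a constant $c>0$ such that for all large $N$ the smallest eigenvalue of $N^{-1}\mathbf A_{\mathcal I}^T\mathbf A_{\mathcal I}$ is at least $c$ for all $\mathcal I\subseteq\{1,\dots,p\}$ with $\mathrm{card}(\mathcal I)\le 2K$. If $\zeta>1-\frac1{2d}$, then $$\Pr\bigl\{\mathrm{EBIC}_R(\mathcal S)<\mathrm{EBIC}_R(\mathcal I)\ \text{ for all } \mathcal I\subseteq\{1,\dots,p\},\ \mathcal I\ne\mathcal S,\ \mathrm{card}(\mathcal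 I)\le K\bigr\}\longrightarrow 1\qquad(N\to\infty).$$ -/

import Mathlib

open Filter Topology MeasureTheory ProbabilityTheory
open scoped NNReal ENNReal Matrix

namespace EBICR

/-! The columns of a design matrix with `N` rows are indexed by `ℕ`; with `p` covariates only the
columns `0, …, p - 1` are used, and models are finite sets `I ⊆ {0, …, p - 1}` of column indices. -/

noncomputable section

/-- The submatrix `A_I` of the columns of `A` with index in `I`. -/
def cols {N : ℕ} (A : Matrix (Fin N) ℕ ℝ) (I : Finset ℕ) : Matrix (Fin N) I ℝ :=
  A.submatrix id (fun j : I => (j : ℕ))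

/-- The Gram matrix `A_Iᵀ A_I`. -/
def gram {N : ℕ} (A : Matrix (Fin N) ℕ ℝ) (I : Finset ℕ) : Matrix I I ℝ :=
  (cols A I)ᵀ * cols A I

/-- `Π_I = A_I (A_Iᵀ A_I)⁻¹ A_Iᵀ`, the orthogonal projection onto the span of the columns in `I`
(when these are linearly independent). -/
def proj {N : ℕ} (A : Matrix (Fin N) ℕ ℝ) (I : Finset ℕ) : Matrix (Fin N) (Fin N) ℝ :=
  cols A I * (gram A I)⁻¹ * (cols A I)ᵀ

/-- The maximum likelihood estimate `σ̂_I² = yᵀ (1 - Π_I) y / N` of the noise variance. -/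
def sigmaHatSq {N : ℕ} (A : Matrix (Fin N) ℕ ℝ) (y : Fin N → ℝ) (I : Finset ℕ) : ℝ :=
  (y ⬝ᵥ ((1 - proj A I) *ᵥ y)) / N

/-- `σ̂_0² = ‖y‖² / N`. -/
def sigmaHatZeroSq {N : ℕ} (y : Fin N → ℝ) : ℝ :=
  (y ⬝ᵥ y) / N

/-- The criterion `EBIC_R(I)` with tuning parameter `ζ`, for `p` covariates:
`N ln σ̂_I² + k ln (N / 2π) + (k + 2) ln (σ̂_0² / σ̂_I²) + 2 k ζ ln p`, where `k = card I`. -/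
def ebicR {N : ℕ} (ζ : ℝ) (p : ℕ) (A : Matrix (Fin N) ℕ ℝ) (y : Fin N → ℝ) (I : Finset ℕ) : ℝ :=
  N * Real.log (sigmaHatSq A y I)
    + I.card * Real.log (N / (2 * Real.pi))
    + (I.card + 2) * Real.log (sigmaHatZeroSq y / sigmaHatSq A y I)
    + 2 * I.card * ζ * Real.log p

/-- The noise-free response `A x`, with the first `p` columns. -/
def signal {N : ℕ} (p : ℕ) (A : Matrix (Fin N) ℕ ℝ) (x : ℕ →₀ ℝ) : Fin N → ℝ :=
  fun i => ∑ j ∈ Finset.range p, A i j * x j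

/-- The signal-to-noise ratio `(‖A x‖² / N) / σ²`, with `σ² = v`. -/
def snr {N : ℕ} (p : ℕ) (A : Matrix (Fin N) ℕ ℝ) (x : ℕ →₀ ℝ) (v : ℝ≥0) : ℝ :=
  (signal p A x ⬝ᵥ signal p A x) / N / (v : ℝ)

/-- The law `𝓝(0, v I_N)` of the noise vector: independent centred Gaussian entries of
variance `v`. -/
def noiseLaw (N : ℕ) (v : ℝ≥0) : Measure (Fin N → ℝ) :=
  Measure.pi fun _ => gaussianReal 0 v

/-- The sparse Riesz condition for a sequence of designs `A N` with `p N` columns: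
for every index set `I` with `card I ≤ 2 K`, the normalized Gram matrices `N⁻¹ A_Iᵀ A_I` converge to
a positive definite matrix `M_I`; and, since the number of sets `I ⊆ {0, …, p N - 1}` grows with
`N`, positive definiteness is uniform: for all large `N`, the smallest eigenvalues of the
`N⁻¹ A_Iᵀ A_I` are bounded below by a constant `c > 0` not depending on `I` and `N`. -/
def SparseRiesz (K : ℕ) (p : ℕ → ℕ) (A : ∀ N : ℕ, Matrix (Fin N) ℕ ℝ) : Prop :=
  (∀ I : Finset ℕ, I.card ≤ 2 * K → ∃ M : Matrix I I ℝ, M.PosDef ∧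
    Tendsto (fun N : ℕ => (N : ℝ)⁻¹ • gram (A N) I) atTop (𝓝 M)) ∧
  ∃ c : ℝ, 0 < c ∧ ∀ᶠ N : ℕ in atTop, ∀ I ⊆ Finset.range (p N), I.card ≤ 2 * K →
    ∀ w : I → ℝ, c * (w ⬝ᵥ w) ≤ w ⬝ᵥ (((N : ℝ)⁻¹ • gram (A N) I) *ᵥ w)

/-- The event that the model `S` has strictly smaller criterion than every other model of
cardinality at most `K`, as a set of noise vectors `e`; the data are `y = A x + e`. -/
def selectsTrue {N : ℕ} (ζ : ℝ) (K p : ℕ) (A : Matrix (Fin N) ℕ ℝ) (x : ℕ →₀ ℝ) (S : Finset ℕ) :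
    Set (Fin N → ℝ) :=
  {e | ∀ I ⊆ Finset.range p, I.card ≤ K → I ≠ S →
    ebicR ζ p A (signal p A x + e) S < ebicR ζ p A (signal p A x + e) I}

end

end EBICR

/-! # Selection consistency of the criterion `EBIC_R`

The noise is `e = √v z` with `z` a standard Gaussian vector, and `N σ̂_I²` is the squared distance of
`y = A x + e` from the span `V_I` of the columns in `I` (`EBICR.sigmaHatSq_eq`).  With high
probability three things hold at once, with small `ε > 0` and `α > 1` close to `1`:

* `‖z‖²` lies between `(1 - ε) N` and `4 N`;
* `‖P_J z‖² < ε N` for the projection to every span `V_J` of at most `2 K` columns.  There are only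
  polynomially many `J`, and each inequality fails with exponentially small probability;
* for every `I ⊋ S` with `k` superfluous covariates, the projection of `z` to `V_Sᗮ ⊓ V_I` satisfies
  `‖P z‖² < 2 α k ln p`.  This is a chi-square variable with at most `k` degrees of freedom, so the
  inequality fails with probability about `p ^ (-α k)`, and there are at most `p ^ k` such models.

All of these are Chernoff bounds (`EBICR.stdGaussian_le_norm_sq_starProjection`, which rests on the
fact that a projection of a standard Gaussian vector is standard Gaussian) and union bounds, where
sums over models are evaluated with `∑ T, a ^ card T = (1 + a) ^ p`.

On this event the criterion selects `S` (`EBICR.mem_selectsTrue`).  In an overfitting model the fit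
gains at most about `2 α² k ln p ≈ 2 α² d k ln N` in `N ln σ̂²`, while the penalty grows by
`k (ln N + 2 ζ ln p) + O(k) ≈ (1 + 2 ζ d) k ln N`; the assumption `ζ > 1 - 1 / (2 d)` is exactly
`2 d < 1 + 2 ζ d`.  A model that misses `j ∈ S` leaves at least `c N (x j)²` of the signal
unexplained by the sparse Riesz condition for `I ∪ S`, and the noise variance is bounded since the
signal-to-noise ratio has a positive limit.  So `N ln σ̂²` increases by a multiple of `N`, which
dominates all penalty terms, as these are `O(ln N)`.  The terms `(k + 2) ln (σ̂_0² / σ̂_I²)` are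
nonnegative and increase along nested models, and the one of `S` is bounded.
-/

namespace EBICR

/-! ### Chi-square tail bounds for projections of a standard Gaussian vector -/

section Gaussian

variable {E : Type*} [NormedAddCommGroup E] [InnerProductSpace ℝ E] [FiniteDimensional ℝ E]
  [MeasurableSpace E] [BorelSpace E]

lemma integral_exp_mul_sq_gaussianReal {t : ℝ} (ht : t < 1 / 2) :
    ∫ x, Real.exp (t * x ^ 2) ∂(gaussianReal 0 1) = (√(1 - 2 * t))⁻¹ := by
  rw [integral_gaussianReal_eq_integral_smul (by norm_num)]
  have h : ∀ x : ℝ, gaussianPDFReal 0 1 x • Real.exp (t * x ^ 2)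
      = (√(2 * Real.pi))⁻¹ * Real.exp (-(1 / 2 - t) * x ^ 2) := by
    intro x
    simp only [gaussianPDFReal, NNReal.coe_one, mul_one, sub_zero, smul_eq_mul]
    rw [mul_assoc, ← Real.exp_add]
    congr 2
    ring
  simp_rw [h]
  rw [integral_const_mul, integral_gaussian, ← Real.sqrt_inv, ← Real.sqrt_inv, ← Real.sqrt_mul
    (by positivity)]
  congr 1
  have h1 : 1 / 2 - t ≠ 0 := by linarith
  have h2 : 1 - 2 * t ≠ 0 := by linarith
  have := Real.pi_ne_zero
  field_simp

/-- The moment generating function of a chi-square variable with `dim E` degrees of freedom. -/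
lemma mgf_norm_sq_stdGaussian {t : ℝ} (ht : t < 1 / 2) :
    mgf (fun z => ‖z‖ ^ 2) (stdGaussian E) t = (√(1 - 2 * t))⁻¹ ^ Module.finrank ℝ E := by
  have hb : ∀ x : Fin (Module.finrank ℝ E) → ℝ,
      Real.exp (t * ‖∑ i, x i • stdOrthonormalBasis ℝ E i‖ ^ 2)
        = ∏ i, Real.exp (t * x i ^ 2) := by
    intro x
    rw [← Real.exp_sum, ← Finset.mul_sum, ← (stdOrthonormalBasis ℝ E).sum_sq_norm_inner_right]
    congr 3 with i
    rw [(stdOrthonormalBasis ℝ E).orthonormal.inner_right_fintype, Real.norm_eq_abs, sq_abs]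
  rw [mgf, stdGaussian, integral_map (Measurable.aemeasurable (by fun_prop))
    (Measurable.aestronglyMeasurable (by fun_prop))]
  simp_rw [hb]
  rw [integral_fintype_prod_eq_prod (f := fun _ x => Real.exp (t * x ^ 2))]
  simp [integral_exp_mul_sq_gaussianReal ht]

lemma integrable_exp_mul_norm_sq_stdGaussian {t : ℝ} (ht : t < 1 / 2) :
    Integrable (fun z => Real.exp (t * ‖z‖ ^ 2)) (stdGaussian E) := by
  by_contra h
  have h0 := mgf_norm_sq_stdGaussian (E := E) ht
  rw [mgf, integral_undef h] at h0
  have : 0 < (√(1 - 2 * t))⁻¹ := inv_pos.2 (Real.sqrt_pos.2 (by linarith))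
  exact (pow_pos this _).ne h0

lemma stdGaussian_norm_sq_le {t : ℝ} (ht : t ≤ 0) (s : ℝ) :
    (stdGaussian E).real {z | ‖z‖ ^ 2 ≤ s}
      ≤ Real.exp (-t * s) * (√(1 - 2 * t))⁻¹ ^ Module.finrank ℝ E := by
  rw [← mgf_norm_sq_stdGaussian (by linarith)]
  exact measure_le_le_exp_mul_mgf s ht
    (integrable_exp_mul_norm_sq_stdGaussian (by linarith))

lemma stdGaussian_le_norm_sq {t : ℝ} (ht : 0 ≤ t) (ht' : t < 1 / 2) (s : ℝ) :
    (stdGaussian E).real {z | s ≤ ‖z‖ ^ 2}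
      ≤ Real.exp (-t * s) * (√(1 - 2 * t))⁻¹ ^ Module.finrank ℝ E := by
  rw [← mgf_norm_sq_stdGaussian ht']
  exact measure_ge_le_exp_mul_mgf s ht (integrable_exp_mul_norm_sq_stdGaussian ht')

/-- The orthogonal projection of a standard Gaussian vector is standard Gaussian. -/
lemma stdGaussian_map_orthogonalProjectionOnto (W : Submodule ℝ E) :
    (stdGaussian E).map W.orthogonalProjectionOnto = stdGaussian W := by
  have : IsProbabilityMeasure ((stdGaussian E).map W.orthogonalProjectionOnto) :=
    Measure.isProbabilityMeasure_map (Measurable.aemeasurable (by fun_prop))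
  apply Measure.ext_of_charFun
  ext t
  rw [charFun_stdGaussian, charFun_apply, integral_map (Measurable.aemeasurable (by fun_prop))
    (Measurable.aestronglyMeasurable (by fun_prop)),
    show ‖t‖ = ‖(t : E)‖ from rfl, ← charFun_stdGaussian, charFun_apply]
  simp

/-- Chernoff bound for the squared length of the projection of a standard Gaussian vector to a
subspace of dimension at most `m`. -/
lemma stdGaussian_le_norm_sq_starProjection (W : Submodule ℝ E) {m : ℕ}
    (hm : Module.finrank ℝ W ≤ m) {t : ℝ} (ht : 0 ≤ t) (ht' : t < 1 / 2) (s : ℝ) :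
    (stdGaussian E).real {z | s ≤ ‖W.starProjection z‖ ^ 2}
      ≤ Real.exp (-t * s) * (√(1 - 2 * t))⁻¹ ^ m := by
  have h : {z : E | s ≤ ‖W.starProjection z‖ ^ 2}
      = W.orthogonalProjectionOnto ⁻¹' {w : W | s ≤ ‖w‖ ^ 2} := by
    ext z
    simp only [Set.mem_ofPred_eq, Set.mem_preimage, Submodule.starProjection_apply,
      Submodule.coe_norm]
  rw [h, ← map_measureReal_apply (by fun_prop) (measurableSet_le (by fun_prop) (by fun_prop)),
    stdGaussian_map_orthogonalProjectionOnto]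
  refine (stdGaussian_le_norm_sq ht ht' s).trans ?_
  gcongr
  rw [one_le_inv₀ (Real.sqrt_pos.2 (by linarith)), Real.sqrt_le_one]
  linarith

end Gaussian

/-- The noise vector is `√v` times a standard Gaussian vector of Euclidean space. -/
lemma noiseLaw_eq_map (N : ℕ) (v : ℝ≥0) :
    noiseLaw N v = (stdGaussian (EuclideanSpace ℝ (Fin N))).map
      (fun z => √(v : ℝ) • WithLp.ofLp z) := by
  rw [← map_pi_eq_stdGaussian, Measure.map_map (by fun_prop) (by fun_prop), noiseLaw]
  have h : ((fun z : EuclideanSpace ℝ (Fin N) => √(v : ℝ) • WithLp.ofLp z) ∘ WithLp.toLp 2)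
      = fun (x : Fin N → ℝ) i => √(v : ℝ) * x i := by
    ext x i
    simp
  have hg : gaussianReal 0 v = (gaussianReal 0 1).map (fun x => √(v : ℝ) * x) := by
    rw [gaussianReal_map_const_mul]
    congr 1
    · simp
    · ext
      simp
  rw [h, Measure.pi_map_pi (μ := fun _ : Fin N => gaussianReal 0 1)
    (f := fun _ x => √(v : ℝ) * x) (fun _ => by fun_prop), ← hg]

/-! ### Residual sums of squares as distances to column spans -/

/-- The span of the columns of `A` with index in `I`, as a subspace of Euclidean space. -/
def colSpan {N : ℕ} (A : Matrix (Fin N) ℕ ℝ) (I : Finset ℕ) :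
    Submodule ℝ (EuclideanSpace ℝ (Fin N)) :=
  Submodule.span ℝ ((fun j => WithLp.toLp 2 (fun i => A i j)) '' (I : Set ℕ))

section ColumnSpan

variable {N : ℕ} {A : Matrix (Fin N) ℕ ℝ} {I J S : Finset ℕ}

lemma colSpan_mono (h : I ⊆ J) : colSpan A I ≤ colSpan A J :=
  Submodule.span_mono (Set.image_mono (by exact_mod_cast h))

lemma finrank_colSpan_le (A : Matrix (Fin N) ℕ ℝ) (I : Finset ℕ) :
    Module.finrank ℝ (colSpan A I) ≤ I.card := by
  classical
  rw [colSpan, ← Finset.coe_image]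
  exact (finrank_span_finset_le_card _).trans Finset.card_image_le

lemma finrank_orthogonal_inf_colSpan_le (h : S ⊆ I) :
    Module.finrank ℝ ((colSpan A S)ᗮ ⊓ colSpan A I : Submodule ℝ (EuclideanSpace ℝ (Fin N)))
      ≤ (I \ S).card := by
  have h1 := Submodule.finrank_add_inf_finrank_orthogonal (colSpan_mono (A := A) h)
  have h2 : colSpan A I = colSpan A S ⊔ colSpan A (I \ S) := by
    rw [colSpan, colSpan, colSpan, ← Submodule.span_union, ← Set.image_union]
    congr 2
    rw [Finset.coe_sdiff, Set.union_sdiff_cancel (by exact_mod_cast h)]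
  have h3 := Submodule.finrank_add_le_finrank_add_finrank (colSpan A S) (colSpan A (I \ S))
  have h4 := finrank_colSpan_le A (I \ S)
  rw [← h2] at h3
  omega

lemma toLp_cols_mulVec (w : I → ℝ) :
    (WithLp.toLp 2 (cols A I *ᵥ w) : EuclideanSpace ℝ (Fin N))
      = ∑ j : I, w j • WithLp.toLp 2 (fun i => A i j) := by
  ext i
  simp [cols, Matrix.mulVec, dotProduct, mul_comm]

lemma toLp_cols_mulVec_mem (w : I → ℝ) : WithLp.toLp 2 (cols A I *ᵥ w) ∈ colSpan A I := by
  rw [toLp_cols_mulVec]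
  exact Submodule.sum_mem _ fun j _ => Submodule.smul_mem _ _
    (Submodule.subset_span ⟨j, j.2, rfl⟩)

lemma mem_colSpan_iff {z : EuclideanSpace ℝ (Fin N)} :
    z ∈ colSpan A I ↔ ∃ w : I → ℝ, WithLp.toLp 2 (cols A I *ᵥ w) = z := by
  refine ⟨fun h => ?_, ?_⟩
  · induction h using Submodule.span_induction with
    | mem z hz =>
      obtain ⟨j, hj, rfl⟩ := hz
      refine ⟨Pi.single ⟨j, hj⟩ 1, ?_⟩
      ext i
      simp [cols]
    | zero => exact ⟨0, by simp⟩
    | add y z _ _ hy hz =>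
      obtain ⟨a, rfl⟩ := hy
      obtain ⟨b, rfl⟩ := hz
      exact ⟨a + b, by simp [Matrix.mulVec_add]⟩
    | smul a z _ hz =>
      obtain ⟨b, rfl⟩ := hz
      exact ⟨a • b, by simp [Matrix.mulVec_smul]⟩
  · rintro ⟨w, rfl⟩
    exact toLp_cols_mulVec_mem w

lemma norm_sq_toLp (y : Fin N → ℝ) :
    ‖(WithLp.toLp 2 y : EuclideanSpace ℝ (Fin N))‖ ^ 2 = y ⬝ᵥ y := by
  rw [EuclideanSpace.real_norm_sq_eq]
  simp [dotProduct, sq]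

lemma norm_sq_toLp_cols_mulVec (w : I → ℝ) :
    ‖(WithLp.toLp 2 (cols A I *ᵥ w) : EuclideanSpace ℝ (Fin N))‖ ^ 2
      = w ⬝ᵥ (gram A I *ᵥ w) := by
  rw [norm_sq_toLp, gram, ← Matrix.mulVec_mulVec, Matrix.dotProduct_mulVec w,
    Matrix.vecMul_transpose]

/-- `Π_I` is the orthogonal projection to the column span when the Gram matrix is invertible. -/
lemma starProjection_colSpan (h : IsUnit (gram A I).det) (y : Fin N → ℝ) :
    (colSpan A I).starProjection (WithLp.toLp 2 y) = WithLp.toLp 2 (proj A I *ᵥ y) := by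
  apply Submodule.eq_starProjection_of_mem_of_inner_eq_zero
  · rw [proj, Matrix.mul_assoc, ← Matrix.mulVec_mulVec]
    exact toLp_cols_mulVec_mem _
  · intro z hz
    obtain ⟨w, rfl⟩ := mem_colSpan_iff.1 hz
    have h1 : (cols A I)ᵀ *ᵥ (y - proj A I *ᵥ y) = 0 := by
      rw [Matrix.mulVec_sub, Matrix.mulVec_mulVec, proj, Matrix.mul_assoc, ← Matrix.mul_assoc,
        ← gram, ← Matrix.mul_assoc, Matrix.mul_nonsing_inv _ h, Matrix.one_mul, sub_self]
    rw [← WithLp.toLp_sub, EuclideanSpace.inner_toLp_toLp, star_trivial, dotProduct_comm,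
      Matrix.dotProduct_mulVec, ← Matrix.mulVec_transpose, h1, zero_dotProduct]

/-- The residual variance is the squared distance of `y` from the column span, divided by `N`. -/
lemma sigmaHatSq_eq (h : IsUnit (gram A I).det) (y : Fin N → ℝ) :
    sigmaHatSq A y I
      = ‖(WithLp.toLp 2 y : EuclideanSpace ℝ (Fin N))
          - (colSpan A I).starProjection (WithLp.toLp 2 y)‖ ^ 2 / N := by
  set P := (colSpan A I).starProjection
  set Y : EuclideanSpace ℝ (Fin N) := WithLp.toLp 2 y
  have h1 : y ⬝ᵥ ((1 - proj A I) *ᵥ y) = inner ℝ Y (Y - P Y) := by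
    rw [starProjection_colSpan h, ← WithLp.toLp_sub, EuclideanSpace.inner_toLp_toLp,
      star_trivial, dotProduct_comm, Matrix.sub_mulVec, Matrix.one_mulVec]
  have h2 : inner ℝ (P Y) (Y - P Y) = 0 := by
    rw [real_inner_comm]
    exact Submodule.starProjection_inner_eq_zero _ _ (Submodule.starProjection_apply_mem _ _)
  rw [sigmaHatSq, h1, ← real_inner_self_eq_norm_sq, inner_sub_left (𝕜 := ℝ) Y (P Y), h2, sub_zero]

lemma isUnit_det_gram {c : ℝ} (hc : 0 < c)
    (h : ∀ w : I → ℝ, c * (w ⬝ᵥ w) ≤ w ⬝ᵥ (((N : ℝ)⁻¹ • gram A I) *ᵥ w)) :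
    IsUnit (gram A I).det := by
  rw [← Matrix.isUnit_iff_isUnit_det, ← Matrix.mulVec_injective_iff_isUnit]
  rw [← Matrix.coe_mulVecLin, ← LinearMap.ker_eq_bot, LinearMap.ker_eq_bot']
  intro w hw
  have h1 := h w
  rw [Matrix.mulVecLin_apply] at hw
  rw [Matrix.smul_mulVec, hw, smul_zero, dotProduct_zero] at h1
  have h2 : 0 ≤ w ⬝ᵥ w := Finset.sum_nonneg fun i _ => mul_self_nonneg _
  exact dotProduct_self_eq_zero.1 (le_antisymm (by nlinarith) h2)

lemma toLp_signal_eq {p : ℕ} {x : ℕ →₀ ℝ} (h : x.support ⊆ Finset.range p) :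
    (WithLp.toLp 2 (signal p A x) : EuclideanSpace ℝ (Fin N))
      = WithLp.toLp 2 (cols A x.support *ᵥ fun j => x j) := by
  congr 1
  ext i
  simp only [signal, cols, Matrix.mulVec, dotProduct, Matrix.submatrix_apply, id]
  rw [Finset.sum_coe_sort x.support (fun j => A i j * x j)]
  refine (Finset.sum_subset h fun j _ hj => ?_).symm
  rw [Finsupp.notMem_support_iff.1 hj, mul_zero]

lemma toLp_signal_mem {p : ℕ} {x : ℕ →₀ ℝ} (h : x.support ⊆ Finset.range p) :
    WithLp.toLp 2 (signal p A x) ∈ colSpan A x.support := by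
  rw [toLp_signal_eq h]
  exact toLp_cols_mulVec_mem _

/-- A model that misses `j` with `x j ≠ 0` leaves at least `c N (x j)²` of the squared length of
the signal unexplained: the residual of the signal is a combination of the columns in
`I ∪ supp x` in which column `j` has coefficient `x j`. -/
lemma le_norm_sq_signal_sub {p : ℕ} {x : ℕ →₀ ℝ} (hx : x.support ⊆ Finset.range p) {c : ℝ}
    (hc : 0 ≤ c) (hN : 0 < N)
    (h : ∀ w : ↥(I ∪ x.support) → ℝ,
      c * (w ⬝ᵥ w) ≤ w ⬝ᵥ (((N : ℝ)⁻¹ • gram A (I ∪ x.support)) *ᵥ w))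
    {j : ℕ} (hj : j ∈ x.support) (hjI : j ∉ I) :
    c * N * x j ^ 2 ≤ ‖(WithLp.toLp 2 (signal p A x) : EuclideanSpace ℝ (Fin N))
      - (colSpan A I).starProjection (WithLp.toLp 2 (signal p A x))‖ ^ 2 := by
  obtain ⟨a, ha⟩ := mem_colSpan_iff.1
    ((colSpan A I).starProjection_apply_mem (WithLp.toLp 2 (signal p A x)))
  let w : ↥(I ∪ x.support) → ℝ := fun i => x i - if hi : (i : ℕ) ∈ I then a ⟨i, hi⟩ else 0
  have hw : (WithLp.toLp 2 (signal p A x) : EuclideanSpace ℝ (Fin N))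
      - (colSpan A I).starProjection (WithLp.toLp 2 (signal p A x))
      = WithLp.toLp 2 (cols A (I ∪ x.support) *ᵥ w) := by
    rw [← ha, toLp_signal_eq hx, ← WithLp.toLp_sub]
    congr 1
    ext i
    simp only [cols, Matrix.mulVec, dotProduct, Matrix.submatrix_apply, id, w, mul_sub,
      Finset.sum_sub_distrib, Pi.sub_apply]
    congr 1
    · rw [Finset.sum_coe_sort x.support (fun j => A i j * x j),
        Finset.sum_coe_sort (I ∪ x.support) (fun j => A i j * x j)]
      refine Finset.sum_subset Finset.subset_union_right fun j _ hj => ?_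
      rw [Finsupp.notMem_support_iff.1 hj, mul_zero]
    · rw [Finset.sum_coe_sort (I ∪ x.support)
        (fun j => A i j * if hi : j ∈ I then a ⟨j, hi⟩ else 0),
        ← Finset.sum_subset (Finset.subset_union_left (s₁ := I) (s₂ := x.support))
          (fun j _ hj => by rw [dif_neg hj, mul_zero]), ← Finset.sum_coe_sort I]
      exact Finset.sum_congr rfl fun j _ => by rw [dif_pos j.2]
  rw [hw, norm_sq_toLp_cols_mulVec]
  have hN' : (0 : ℝ) < N := by exact_mod_cast hN
  have h1 := h w
  rw [Matrix.smul_mulVec, dotProduct_smul, smul_eq_mul, inv_mul_eq_div, le_div_iff₀ hN'] at h1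
  have h2 : x j ^ 2 ≤ w ⬝ᵥ w := by
    have := Finset.single_le_sum (f := fun i => w i * w i) (fun i _ => mul_self_nonneg _)
      (Finset.mem_univ (⟨j, Finset.mem_union_right _ hj⟩ : ↥(I ∪ x.support)))
    simpa [w, hjI, sq, dotProduct] using this
  nlinarith [mul_le_mul_of_nonneg_left h2 (mul_nonneg hc hN'.le)]

end ColumnSpan

section Projections

variable {E : Type*} [NormedAddCommGroup E] [InnerProductSpace ℝ E] [FiniteDimensional ℝ E]
  {U V : Submodule ℝ E}

lemma norm_sq_sub_starProjection (U : Submodule ℝ E) (y : E) :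
    ‖y - U.starProjection y‖ ^ 2 = ‖y‖ ^ 2 - ‖U.starProjection y‖ ^ 2 := by
  have := Submodule.norm_sq_eq_add_norm_sq_starProjection y U
  rw [Submodule.starProjection_orthogonal_val] at this
  linarith

lemma add_sub_starProjection_of_mem {u : E} (hu : u ∈ U) (y : E) :
    u + y - U.starProjection (u + y) = y - U.starProjection y := by
  rw [map_add, Submodule.starProjection_eq_self_iff.2 hu]
  abel

lemma norm_sq_starProjection_of_le (h : V ≤ U) (y : E) :
    ‖U.starProjection y‖ ^ 2
      = ‖V.starProjection y‖ ^ 2 + ‖(Vᗮ ⊓ U : Submodule ℝ E).starProjection y‖ ^ 2 := by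
  have h1 : V.starProjection (U.starProjection y) = V.starProjection y :=
    congrArg (· y) (Submodule.starProjection_comp_starProjection_of_le h)
  have h2 : (Vᗮ ⊓ U : Submodule ℝ E).starProjection y
      = U.starProjection y - V.starProjection y := by
    apply Submodule.eq_starProjection_of_mem_of_inner_eq_zero
    · refine ⟨?_, U.sub_mem (U.starProjection_apply_mem y) (h (V.starProjection_apply_mem y))⟩
      rw [← h1]
      exact Submodule.sub_starProjection_mem_orthogonal _
    · rintro w ⟨hwV, hwU⟩
      rw [← sub_add, inner_add_left, Submodule.starProjection_inner_eq_zero _ _ hwU, zero_add]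
      exact (Submodule.mem_orthogonal _ _).1 hwV _ (V.starProjection_apply_mem y)
  have h3 := norm_sq_sub_starProjection V (U.starProjection y)
  rw [h1, ← h2] at h3
  linarith

lemma norm_sq_starProjection_le_of_le (h : V ≤ U) (y : E) :
    ‖V.starProjection y‖ ^ 2 ≤ ‖U.starProjection y‖ ^ 2 := by
  rw [norm_sq_starProjection_of_le h]
  linarith [sq_nonneg ‖(Vᗮ ⊓ U : Submodule ℝ E).starProjection y‖]

/-- The residual of a signal `m` plus noise `y` with respect to `V`, when `U` contains both `V` and
the signal: the cross term `2 ⟪m - P_V m, y⟫` only sees the projection of the noise to `U`. -/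
lemma le_norm_sq_sub_starProjection_add (h : V ≤ U) {m : E} (hm : m ∈ U) (y : E) :
    ‖m - V.starProjection m‖ ^ 2 / 2 + ‖y‖ ^ 2 - 3 * ‖U.starProjection y‖ ^ 2
      ≤ ‖m + y - V.starProjection (m + y)‖ ^ 2 := by
  set u := m - V.starProjection m with hu
  have huU : u ∈ U := U.sub_mem hm (h (V.starProjection_apply_mem m))
  have h1 : m + y - V.starProjection (m + y) = u + (y - V.starProjection y) := by
    rw [map_add, hu]
    abel
  have h2 : inner ℝ u (y - V.starProjection y) = inner ℝ u (U.starProjection y) := by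
    have h3 : inner ℝ u (V.starProjection y) = 0 :=
      Submodule.starProjection_inner_eq_zero _ _ (V.starProjection_apply_mem y)
    have h4 : inner ℝ (y - U.starProjection y) u = 0 :=
      Submodule.starProjection_inner_eq_zero _ _ huU
    rw [real_inner_comm, inner_sub_right] at h4
    rw [inner_sub_right, h3]
    linarith
  have h5 := abs_le.1 (abs_real_inner_le_norm u (U.starProjection y))
  rw [h1, norm_add_sq_real, h2, norm_sq_sub_starProjection V y]
  nlinarith [norm_sq_starProjection_le_of_le h y, h5.1,
    sq_nonneg (‖u‖ - 2 * ‖U.starProjection y‖)]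

end Projections

/-! ### Comparison of the criterion with that of the true model -/

/-- An overfitting model: `s₀`, `s`, `s'` are the residual variances of the empty model, the true
model (of size `k`) and a larger model (of size `k'`). -/
lemma criterion_lt_of_overfit {n s₀ s s' k k' l ζ b : ℝ} (hn : 0 < n) (hs' : 0 < s')
    (hss' : s' ≤ s) (hs₀ : s ≤ s₀) (hk : 0 ≤ k) (hkk' : k < k')
    (hgap : n * (s - s') ≤ b * (k' - k) * s')
    (hpen : b < Real.log (n / (2 * Real.pi)) + 2 * ζ * l) :
    n * Real.log s + k * Real.log (n / (2 * Real.pi)) + (k + 2) * Real.log (s₀ / s)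
        + 2 * k * ζ * l
      < n * Real.log s' + k' * Real.log (n / (2 * Real.pi)) + (k' + 2) * Real.log (s₀ / s')
        + 2 * k' * ζ * l := by
  have hs : 0 < s := hs'.trans_le hss'
  have h1 : n * (Real.log s - Real.log s') ≤ b * (k' - k) := by
    rw [← Real.log_div hs.ne' hs'.ne']
    have h2 : n * (s / s' - 1) ≤ b * (k' - k) := by
      rw [div_sub_one hs'.ne', ← mul_div_assoc, div_le_iff₀ hs']
      exact hgap
    exact (mul_le_mul_of_nonneg_left (Real.log_le_sub_one_of_pos (by positivity)) hn.le).trans h2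
  have h3 : 0 ≤ Real.log (s₀ / s) := Real.log_nonneg ((one_le_div hs).2 hs₀)
  have h4 : Real.log (s₀ / s) ≤ Real.log (s₀ / s') :=
    Real.log_le_log (div_pos (hs.trans_le hs₀) hs)
      (div_le_div_of_nonneg_left (hs.le.trans hs₀) hs' hss')
  have h5 : (k + 2) * Real.log (s₀ / s) ≤ (k' + 2) * Real.log (s₀ / s') :=
    mul_le_mul (by linarith) h4 h3 (by linarith)
  have h6 := mul_lt_mul_of_pos_right hpen (sub_pos.2 hkk')
  linarith

/-- A model of size `k' ≤ K` whose residual variance `s'` exceeds that of the true model by a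
factor `1 + g`. -/
lemma criterion_lt_of_underfit {n s₀ s s' k k' K l ζ g B : ℝ} (hn : 0 ≤ n) (hs : 0 < s)
    (hg : 0 ≤ g) (hss' : (1 + g) * s ≤ s') (hs₀ : s ≤ s₀) (hs₀' : s' ≤ s₀) (hB : s₀ ≤ B * s)
    (hk : 0 ≤ k) (hkK : k ≤ K) (hk' : 0 ≤ k') (hk'K : k' ≤ K)
    (hpen : K * |Real.log (n / (2 * Real.pi)) + 2 * ζ * l| + (K + 2) * Real.log B
      < n * Real.log (1 + g)) :
    n * Real.log s + k * Real.log (n / (2 * Real.pi)) + (k + 2) * Real.log (s₀ / s)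
        + 2 * k * ζ * l
      < n * Real.log s' + k' * Real.log (n / (2 * Real.pi)) + (k' + 2) * Real.log (s₀ / s')
        + 2 * k' * ζ * l := by
  have hg1 : 0 < 1 + g := by linarith
  have hs' : 0 < s' := (mul_pos hg1 hs).trans_le hss'
  have h1 : n * Real.log (1 + g) ≤ n * (Real.log s' - Real.log s) := by
    rw [← Real.log_div hs'.ne' hs.ne']
    exact mul_le_mul_of_nonneg_left (Real.log_le_log hg1 ((le_div_iff₀ hs).2 hss')) hn
  have h2 : 0 ≤ (k' + 2) * Real.log (s₀ / s') :=
    mul_nonneg (by linarith) (Real.log_nonneg ((one_le_div hs').2 hs₀'))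
  have h3 : 0 ≤ Real.log (s₀ / s) := Real.log_nonneg ((one_le_div hs).2 hs₀)
  have h4 : Real.log (s₀ / s) ≤ Real.log B :=
    Real.log_le_log (div_pos (hs.trans_le hs₀) hs) ((div_le_iff₀ hs).2 hB)
  have h5 : (k + 2) * Real.log (s₀ / s) ≤ (K + 2) * Real.log B :=
    mul_le_mul (by linarith) h4 h3 (by linarith)
  have h6 : -(K * |Real.log (n / (2 * Real.pi)) + 2 * ζ * l|)
      ≤ (k' - k) * (Real.log (n / (2 * Real.pi)) + 2 * ζ * l) := by
    refine le_trans ?_ (neg_abs_le _)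
    rw [abs_mul]
    exact neg_le_neg (mul_le_mul_of_nonneg_right (abs_le.2 ⟨by linarith, by linarith⟩)
      (abs_nonneg _))
  linarith

/-- The part of the selection problem that is not random: if the noise `√v z` is of typical length,
has a small projection to every span of at most `2 K` columns, and its projections to the extra
dimensions of the overfitting models are below their typical maximum, then the criterion selects the
true model.  The squared projections to the extra dimensions are at most `a` per superfluous
covariate, `b` bounds the resulting gain in `N ln σ̂²` per superfluous covariate, and `g` is a lower
bound for the relative increase of `σ̂²` in a model that misses a covariate. -/
theorem mem_selectsTrue {N p K : ℕ} {A : Matrix (Fin N) ℕ ℝ} {x : ℕ →₀ ℝ} {v : ℝ≥0}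
    {ζ c ε a b g s : ℝ} {z : EuclideanSpace ℝ (Fin N)} (hN : 0 < N)
    (hx : x.support ⊆ Finset.range p)
    (hK : x.support.card ≤ K) (hv : 0 < v) (hc : 0 < c)
    (hA : ∀ I ⊆ Finset.range p, I.card ≤ 2 * K →
      ∀ w : I → ℝ, c * (w ⬝ᵥ w) ≤ w ⬝ᵥ (((N : ℝ)⁻¹ • gram A I) *ᵥ w))
    (ha : 0 ≤ a) (hab : a ≤ b * (1 - 2 * ε)) (hε : 2 * ε < 1) (hg : 0 < g) (hεg : 3 * ε ≤ 4 * g)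
    (hxg : ∀ j ∈ x.support, 16 * g * v ≤ c * x j ^ 2) (hs : snr p A x v ≤ s)
    (hz : (1 - ε) * N ≤ ‖z‖ ^ 2) (hz' : ‖z‖ ^ 2 ≤ 4 * N)
    (hJ : ∀ J ⊆ Finset.range p, J.card ≤ 2 * K → ‖(colSpan A J).starProjection z‖ ^ 2 ≤ ε * N)
    (hI : ∀ I ⊆ Finset.range p, x.support ⊂ I →
      ‖((colSpan A x.support)ᗮ ⊓ colSpan A I : Submodule ℝ _).starProjection z‖ ^ 2
        ≤ a * (I \ x.support).card)
    (hover : b < Real.log (N / (2 * Real.pi)) + 2 * ζ * Real.log p)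
    (hunder : K * |Real.log (N / (2 * Real.pi)) + 2 * ζ * Real.log p|
      + (K + 2) * Real.log ((2 * s + 8) / (1 - 2 * ε)) < N * Real.log (1 + g)) :
    √(v : ℝ) • WithLp.ofLp z ∈ selectsTrue ζ K p A x x.support := by
  intro I hIp hIK hIS
  set S := x.support
  set m : EuclideanSpace ℝ (Fin N) := WithLp.toLp 2 (signal p A x) with hm
  set e : EuclideanSpace ℝ (Fin N) := √(v : ℝ) • z with he
  have hN' : (0 : ℝ) < N := by exact_mod_cast hN
  have hv' : (0 : ℝ) < v := by exact_mod_cast hv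
  have hNv : 0 < N * (v : ℝ) := by positivity
  have hε1 : 0 < 1 - 2 * ε := by linarith
  have hmS : m ∈ colSpan A S := toLp_signal_mem hx
  -- all squared lengths of projections of the noise scale with `v`
  have hsq : ∀ W : Submodule ℝ (EuclideanSpace ℝ (Fin N)),
      ‖W.starProjection e‖ ^ 2 = v * ‖W.starProjection z‖ ^ 2 := by
    intro W
    rw [he, map_smul, norm_smul, mul_pow, Real.norm_eq_abs, sq_abs, Real.sq_sqrt hv'.le]
  have hes : ‖e‖ ^ 2 = v * ‖z‖ ^ 2 := by
    rw [he, norm_smul, mul_pow, Real.norm_eq_abs, sq_abs, Real.sq_sqrt hv'.le]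
  have hsig : ∀ J ⊆ Finset.range p, J.card ≤ 2 * K →
      sigmaHatSq A (signal p A x + √(v : ℝ) • WithLp.ofLp z) J
        = ‖m + e - (colSpan A J).starProjection (m + e)‖ ^ 2 / N := fun J h1 h2 =>
    sigmaHatSq_eq (isUnit_det_gram hc (hA J h1 h2)) _
  have hsig0 : sigmaHatZeroSq (signal p A x + √(v : ℝ) • WithLp.ofLp z) = ‖m + e‖ ^ 2 / N := by
    rw [sigmaHatZeroSq, ← norm_sq_toLp]
    rfl
  have hle0 : ∀ J, ‖m + e - (colSpan A J).starProjection (m + e)‖ ^ 2 / N ≤ ‖m + e‖ ^ 2 / N := by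
    intro J
    rw [norm_sq_sub_starProjection]
    gcongr
    linarith [sq_nonneg ‖(colSpan A J).starProjection (m + e)‖]
  -- a model that contains the true one leaves at least `(1 - 2 ε) N v` unexplained
  have hlow : ∀ J ⊆ Finset.range p, J.card ≤ 2 * K → S ⊆ J →
      (1 - 2 * ε) * (N * v) ≤ ‖m + e - (colSpan A J).starProjection (m + e)‖ ^ 2 := by
    intro J h1 h2 h3
    rw [add_sub_starProjection_of_mem (colSpan_mono h3 hmS), norm_sq_sub_starProjection, hes, hsq]
    nlinarith [mul_le_mul_of_nonneg_left hz hv'.le, mul_le_mul_of_nonneg_left (hJ J h1 h2) hv'.le]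
  have hSlow := hlow S hx (by omega) subset_rfl
  have hSpos := (mul_pos hε1 hNv).trans_le hSlow
  simp only [ebicR]
  rw [hsig S hx (by omega), hsig I hIp (by omega), hsig0]
  by_cases hSI : S ⊆ I
  · have hss : S ⊂ I := hSI.ssubset_of_ne (Ne.symm hIS)
    have hIlow := hlow I hIp (by omega) hSI
    have hdiff : ‖m + e - (colSpan A S).starProjection (m + e)‖ ^ 2
        - ‖m + e - (colSpan A I).starProjection (m + e)‖ ^ 2
        = v * ‖((colSpan A S)ᗮ ⊓ colSpan A I : Submodule ℝ _).starProjection z‖ ^ 2 := by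
      rw [add_sub_starProjection_of_mem hmS, add_sub_starProjection_of_mem (colSpan_mono hSI hmS),
        norm_sq_sub_starProjection, norm_sq_sub_starProjection,
        norm_sq_starProjection_of_le (colSpan_mono hSI), hsq (_ ⊓ _)]
      ring
    have hcard : ((I \ S).card : ℝ) = I.card - S.card := by
      rw [Finset.card_sdiff_of_subset hSI, Nat.cast_sub (Finset.card_le_card hSI)]
    have hb : 0 ≤ b := by
      by_contra! hb
      nlinarith
    apply criterion_lt_of_overfit (b := b) hN' _ _ (hle0 S) (Nat.cast_nonneg _)
      (by exact_mod_cast Finset.card_lt_card hss) _ hover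
    · exact div_pos ((mul_pos hε1 hNv).trans_le hIlow) hN'
    · gcongr ?_ / _
      have : 0 ≤ v * ‖((colSpan A S)ᗮ ⊓ colSpan A I : Submodule ℝ _).starProjection z‖ ^ 2 := by
        positivity
      linarith
    · rw [← sub_div, mul_div_cancel₀ _ hN'.ne', hdiff, ← hcard]
      have hIS' := hI I hIp hss
      calc _ ≤ v * (a * (I \ S).card) := by gcongr
        _ ≤ v * (b * (1 - 2 * ε) * (I \ S).card) := by gcongr
        _ = b * (I \ S).card * ((1 - 2 * ε) * (N * v) / N) := by field_simp
        _ ≤ _ := by gcongr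
  · obtain ⟨j, hj, hjI⟩ := Finset.not_subset.1 hSI
    have hUp : I ∪ S ⊆ Finset.range p := Finset.union_subset hIp hx
    have hUK : (I ∪ S).card ≤ 2 * K := (Finset.card_union_le _ _).trans (by omega)
    have h1 := le_norm_sq_signal_sub hx hc.le hN (hA _ hUp hUK) hj hjI
    have h2 := le_norm_sq_sub_starProjection_add
      (colSpan_mono (A := A) (Finset.subset_union_left (s₁ := I) (s₂ := S)))
      (colSpan_mono Finset.subset_union_right hmS) e
    have h3 := mul_le_mul_of_nonneg_right (hxg j hj) hN'.le
    have h4 := mul_le_mul_of_nonneg_left (hJ _ hUp hUK) hv'.le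
    have h5 := mul_le_mul_of_nonneg_left hz' hv'.le
    have h6 := mul_le_mul_of_nonneg_right hεg hNv.le
    rw [← hsq] at h4
    rw [← hes] at h5
    have hgap : (1 + g) * ‖e‖ ^ 2 ≤ ‖m + e - (colSpan A I).starProjection (m + e)‖ ^ 2 := by
      have h7 := mul_le_mul_of_nonneg_left h5 hg.le
      linarith
    have hSe : ‖m + e - (colSpan A S).starProjection (m + e)‖ ^ 2 ≤ ‖e‖ ^ 2 := by
      rw [add_sub_starProjection_of_mem hmS, norm_sq_sub_starProjection]
      linarith [sq_nonneg ‖(colSpan A S).starProjection e‖]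
    apply criterion_lt_of_underfit (g := g) (B := (2 * s + 8) / (1 - 2 * ε)) (K := K) hN'.le
      (div_pos hSpos hN') hg.le _ (hle0 S) (hle0 I) _ (Nat.cast_nonneg _) (by exact_mod_cast hK)
      (Nat.cast_nonneg _) (by exact_mod_cast hIK) hunder
    · rw [← mul_div_assoc]
      gcongr ?_ / _
      exact (mul_le_mul_of_nonneg_left hSe (by linarith)).trans hgap
    · rw [← mul_div_assoc]
      gcongr ?_ / _
      have h8 : ‖m‖ ^ 2 ≤ s * (N * v) := by
        rw [snr, div_div, div_le_iff₀ hNv] at hs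
        rwa [hm, norm_sq_toLp]
      have h9 : ‖m + e‖ ^ 2 ≤ 2 * ‖m‖ ^ 2 + 2 * ‖e‖ ^ 2 := by
        linarith [parallelogram_law_with_norm ℝ m e, mul_self_nonneg ‖m - e‖, sq ‖m + e‖, sq ‖m‖,
          sq ‖e‖]
      have h10 : 0 ≤ (2 * s + 8) / (1 - 2 * ε) := by
        refine div_nonneg ?_ hε1.le
        have : 0 ≤ s * (N * v) := (sq_nonneg _).trans h8
        linarith [nonneg_of_mul_nonneg_left this hNv]
      calc _ ≤ (2 * s + 8) * (N * v) := by linarith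
        _ = (2 * s + 8) / (1 - 2 * ε) * ((1 - 2 * ε) * (N * v)) := by field_simp
        _ ≤ _ := by gcongr

/-! ### Union bounds over models -/

section Union

variable {E : Type*} [NormedAddCommGroup E] [InnerProductSpace ℝ E] [FiniteDimensional ℝ E]
  [MeasurableSpace E] [BorelSpace E]

/-- Union bound over all nonempty index sets `T`, with a threshold proportional to `card T`; the sum
of `a ^ card T` over all `T` is `(1 + a) ^ p`. -/
lemma stdGaussian_exists_nonempty_le (W : Finset ℕ → Submodule ℝ E)
    (hW : ∀ T, Module.finrank ℝ (W T) ≤ T.card) (p : ℕ) {t : ℝ} (ht : 0 ≤ t) (ht' : t < 1 / 2)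
    (r : ℝ) :
    (stdGaussian E).real {z | ∃ T ⊆ Finset.range p, T.Nonempty ∧
        r * T.card ≤ ‖(W T).starProjection z‖ ^ 2}
      ≤ Real.exp (p * (Real.exp (-t * r) * (√(1 - 2 * t))⁻¹)) - 1 := by
  set a := Real.exp (-t * r) * (√(1 - 2 * t))⁻¹ with ha
  have ha0 : 0 ≤ a := by positivity
  have hset : {z | ∃ T ⊆ Finset.range p, T.Nonempty ∧ r * T.card ≤ ‖(W T).starProjection z‖ ^ 2}
      = ⋃ T ∈ (Finset.range p).powerset.erase ∅,
        {z | r * T.card ≤ ‖(W T).starProjection z‖ ^ 2} := by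
    ext z
    simp only [Set.mem_ofPred_eq, Set.mem_iUnion, Finset.mem_erase, Finset.mem_powerset,
      Finset.nonempty_iff_ne_empty, exists_prop]
    exact exists_congr fun T => by tauto
  rw [hset]
  calc _ ≤ ∑ T ∈ (Finset.range p).powerset.erase ∅,
        (stdGaussian E).real {z | r * T.card ≤ ‖(W T).starProjection z‖ ^ 2} :=
        measureReal_biUnion_finset_le _ _
    _ ≤ ∑ T ∈ (Finset.range p).powerset.erase ∅, a ^ T.card := by
        refine Finset.sum_le_sum fun T _ => ?_
        refine (stdGaussian_le_norm_sq_starProjection (W T) (hW T) ht ht' _).trans_eq ?_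
        rw [ha, mul_pow, ← Real.exp_nat_mul]
        congr 2
        ring
    _ = (a + 1) ^ p - 1 := by
        have h := Finset.sum_pow_mul_eq_add_pow a 1 (Finset.range p)
        rw [← Finset.add_sum_erase _ _ (Finset.empty_mem_powerset _)] at h
        simp only [one_pow, mul_one, Finset.card_empty, pow_zero, Finset.card_range] at h
        linarith
    _ ≤ _ := by
        rw [Real.exp_nat_mul]
        gcongr
        exact Real.add_one_le_exp a

/-- Union bound over all index sets `J` with at most `m` elements, with a fixed threshold. -/
lemma stdGaussian_exists_card_le (W : Finset ℕ → Submodule ℝ E)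
    (hW : ∀ J, Module.finrank ℝ (W J) ≤ J.card) {p : ℕ} (hp : 0 < p) (m : ℕ) {t : ℝ} (ht : 0 ≤ t)
    (ht' : t < 1 / 2) (s : ℝ) :
    (stdGaussian E).real {z | ∃ J ⊆ Finset.range p, J.card ≤ m ∧
        s ≤ ‖(W J).starProjection z‖ ^ 2}
      ≤ Real.exp (-t * s) * (√(1 - 2 * t))⁻¹ ^ m * p ^ m * Real.exp 1 := by
  have hp' : (1 : ℝ) ≤ p := by exact_mod_cast hp
  have hp0 : (p : ℝ) ≠ 0 := by positivity
  have hset : {z | ∃ J ⊆ Finset.range p, J.card ≤ m ∧ s ≤ ‖(W J).starProjection z‖ ^ 2}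
      = ⋃ J ∈ (Finset.range p).powerset.filter (fun J => J.card ≤ m),
        {z | s ≤ ‖(W J).starProjection z‖ ^ 2} := by
    ext z
    simp only [Set.mem_ofPred_eq, Set.mem_iUnion, Finset.mem_filter, Finset.mem_powerset,
      exists_prop]
    exact exists_congr fun T => by tauto
  rw [hset]
  set D := Real.exp (-t * s) * (√(1 - 2 * t))⁻¹ ^ m * p ^ m with hD
  calc _ ≤ ∑ J ∈ (Finset.range p).powerset.filter (fun J => J.card ≤ m),
        (stdGaussian E).real {z | s ≤ ‖(W J).starProjection z‖ ^ 2} :=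
        measureReal_biUnion_finset_le _ _
    _ ≤ ∑ J ∈ (Finset.range p).powerset.filter (fun J => J.card ≤ m),
        D * (p : ℝ)⁻¹ ^ J.card := by
        refine Finset.sum_le_sum fun J hJ => ?_
        have hJm := (Finset.mem_filter.1 hJ).2
        refine (stdGaussian_le_norm_sq_starProjection (W J) ((hW J).trans hJm) ht ht' _).trans ?_
        rw [hD, mul_assoc _ ((p : ℝ) ^ m)]
        refine le_mul_of_one_le_right (by positivity) ?_
        rw [inv_pow, ← div_eq_mul_inv, one_le_div (by positivity)]
        exact pow_le_pow_right₀ hp' hJm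
    _ ≤ ∑ J ∈ (Finset.range p).powerset, D * (p : ℝ)⁻¹ ^ J.card :=
        Finset.sum_le_sum_of_subset_of_nonneg (Finset.filter_subset _ _)
          fun _ _ _ => by positivity
    _ = D * ((p : ℝ)⁻¹ + 1) ^ p := by
        have h := Finset.sum_pow_mul_eq_add_pow (p : ℝ)⁻¹ 1 (Finset.range p)
        simp only [one_pow, mul_one, Finset.card_range] at h
        rw [← Finset.mul_sum, h]
    _ ≤ _ := by
        have h : Real.exp 1 = Real.exp (p : ℝ)⁻¹ ^ p := by
          rw [← Real.exp_nat_mul, mul_inv_cancel₀ hp0]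
        rw [h]
        gcongr
        exact Real.add_one_le_exp _

end Union

/-! ### Growth of the number of covariates -/

section Growth

variable {d : ℝ} {p : ℕ → ℕ}

lemma tendsto_log_sub_mul_log (hd : 0 < d) (hp : ∀ N : ℕ, |(p N : ℝ) - (N : ℝ) ^ d| < 1) :
    Tendsto (fun N : ℕ => Real.log (p N) - d * Real.log N) atTop (𝓝 0) := by
  have hN : Tendsto (fun N : ℕ => (N : ℝ) ^ d) atTop atTop :=
    (tendsto_rpow_atTop hd).comp tendsto_natCast_atTop_atTop
  have h1 : Tendsto (fun N : ℕ => (p N : ℝ) / (N : ℝ) ^ d) atTop (𝓝 1) := by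
    rw [← tendsto_sub_nhds_zero_iff]
    refine squeeze_zero_norm' ?_ hN.inv_tendsto_atTop
    filter_upwards [hN.eventually_gt_atTop 0] with N hN0
    rw [div_sub_one hN0.ne', Real.norm_eq_abs, abs_div, abs_of_pos hN0, Pi.inv_apply, inv_eq_one_div]
    gcongr
    exact (hp N).le
  have h2 := h1.log one_ne_zero
  rw [Real.log_one] at h2
  refine h2.congr' ?_
  filter_upwards [hN.eventually_gt_atTop 1, eventually_gt_atTop 0] with N hN1 hN0
  have hpN : (0 : ℝ) < p N := by linarith [(abs_lt.1 (hp N)).1]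
  rw [Real.log_div hpN.ne' (by linarith), Real.log_rpow (by exact_mod_cast hN0)]

lemma tendsto_card_covariates (hd : 0 < d) (hp : ∀ N : ℕ, |(p N : ℝ) - (N : ℝ) ^ d| < 1) :
    Tendsto p atTop atTop := by
  have hN : Tendsto (fun N : ℕ => (N : ℝ) ^ d) atTop atTop :=
    (tendsto_rpow_atTop hd).comp tendsto_natCast_atTop_atTop
  rw [← tendsto_natCast_atTop_iff (R := ℝ)]
  exact tendsto_atTop_mono (fun N => by linarith [(abs_lt.1 (hp N)).1])
    (tendsto_atTop_add_const_right _ (-1) hN)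

lemma tendsto_log_natCast_div : Tendsto (fun N : ℕ => Real.log N / N) atTop (𝓝 0) :=
  (Real.isLittleO_log_id_atTop.tendsto_div_nhds_zero).comp tendsto_natCast_atTop_atTop

lemma tendsto_log_card_div (hd : 0 < d) (hp : ∀ N : ℕ, |(p N : ℝ) - (N : ℝ) ^ d| < 1) :
    Tendsto (fun N : ℕ => Real.log (p N) / N) atTop (𝓝 0) := by
  have h := ((tendsto_log_sub_mul_log hd hp).mul
    (tendsto_inv_atTop_nhds_zero_nat (𝕜 := ℝ))).add (tendsto_log_natCast_div.const_mul d)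
  simp only [mul_zero, add_zero] at h
  exact h.congr fun N => by ring

lemma log_div_two_pi {N : ℕ} (hN : N ≠ 0) :
    Real.log (N / (2 * Real.pi)) = Real.log N - Real.log (2 * Real.pi) :=
  Real.log_div (by exact_mod_cast hN) (by positivity)

/-- The penalty per covariate, about `(1 + 2 ζ d) ln N`, exceeds the gain per superfluous
covariate, about `b d ln N`. -/
lemma eventually_penalty_gt (hd : 0 < d) (hp : ∀ N : ℕ, |(p N : ℝ) - (N : ℝ) ^ d| < 1)
    {b ζ : ℝ} (hb : b * d < 1 + 2 * ζ * d) :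
    ∀ᶠ N : ℕ in atTop,
      b * Real.log (p N) < Real.log (N / (2 * Real.pi)) + 2 * ζ * Real.log (p N) := by
  have hlog : Tendsto (fun N : ℕ => Real.log N) atTop atTop :=
    Real.tendsto_log_atTop.comp tendsto_natCast_atTop_atTop
  have h := (hlog.const_mul_atTop (sub_pos.2 hb)).atTop_add
    (((tendsto_log_sub_mul_log hd hp).const_mul (2 * ζ - b)).sub_const (Real.log (2 * Real.pi)))
  filter_upwards [h.eventually_gt_atTop 0, eventually_ne_atTop 0] with N h1 h2
  rw [log_div_two_pi h2]
  linarith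

/-- The penalties are negligible compared with `N`. -/
lemma eventually_penalty_lt (hd : 0 < d) (hp : ∀ N : ℕ, |(p N : ℝ) - (N : ℝ) ^ d| < 1)
    (ζ K B : ℝ) {g : ℝ} (hg : 0 < g) :
    ∀ᶠ N : ℕ in atTop,
      K * |Real.log (N / (2 * Real.pi)) + 2 * ζ * Real.log (p N)| + B < N * g := by
  have hinv := tendsto_inv_atTop_nhds_zero_nat (𝕜 := ℝ)
  have h1 := (tendsto_log_natCast_div.sub (hinv.const_mul (Real.log (2 * Real.pi)))).add
    ((tendsto_log_card_div hd hp).const_mul (2 * ζ))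
  have h2 := (h1.abs.const_mul K).add (hinv.const_mul B)
  simp only [mul_zero, sub_zero, add_zero, abs_zero] at h2
  filter_upwards [h2.eventually_lt_const hg, eventually_gt_atTop 0] with N h3 hN
  have hN' : (0 : ℝ) < N := by exact_mod_cast hN
  rw [log_div_two_pi hN.ne']
  have h4 : Real.log N / N - Real.log (2 * Real.pi) * (N : ℝ)⁻¹ + 2 * ζ * (Real.log (p N) / N)
      = (Real.log N - Real.log (2 * Real.pi) + 2 * ζ * Real.log (p N)) / N := by ring
  rw [h4, abs_div, abs_of_pos hN', ← div_eq_mul_inv, ← mul_div_assoc, ← add_div,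
    div_lt_iff₀ hN'] at h3
  linarith

end Growth

/-! ### The exceptional events have vanishing probability -/

lemma tendsto_stdGaussian_norm_sq_ge :
    Tendsto (fun N : ℕ => (stdGaussian (EuclideanSpace ℝ (Fin N))).real {z | 4 * N ≤ ‖z‖ ^ 2})
      atTop (𝓝 0) := by
  have hb : Real.exp (-1) * (√(1 / 2 : ℝ))⁻¹ < 1 := by
    have h1 : Real.exp (-1) < 1 / 2 := by
      rw [Real.exp_neg, ← one_div]
      exact one_div_lt_one_div_of_lt two_pos (by linarith [Real.exp_one_gt_d9])
    rw [← div_eq_mul_inv, div_lt_one (by positivity)]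
    refine h1.trans_le (Real.le_sqrt_of_sq_le (by norm_num))
  refine squeeze_zero (fun _ => measureReal_nonneg) (fun N => ?_)
    (tendsto_pow_atTop_nhds_zero_of_lt_one (by positivity) hb)
  refine (stdGaussian_le_norm_sq (t := 1 / 4) (by norm_num) (by norm_num) _).trans_eq ?_
  rw [finrank_euclideanSpace_fin, mul_pow, ← Real.exp_nat_mul]
  norm_num
  ring

lemma tendsto_stdGaussian_norm_sq_le {ε : ℝ} (hε : 0 < ε) (hε1 : ε < 1) :
    Tendsto (fun N : ℕ => (stdGaussian (EuclideanSpace ℝ (Fin N))).real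
      {z | ‖z‖ ^ 2 ≤ (1 - ε) * N}) atTop (𝓝 0) := by
  -- the Chernoff bound with exponent `ε / 4`
  have hb : Real.exp (ε / 4 * (1 - ε)) * (√(1 + ε / 2))⁻¹ < 1 := by
    rw [← div_eq_mul_inv, div_lt_one (by positivity)]
    refine Real.lt_sqrt_of_sq_lt ?_
    rw [← Real.exp_nat_mul]
    set s := ε / 2 * (1 - ε) with hs
    have h1 : ((2 : ℕ) : ℝ) * (ε / 4 * (1 - ε)) = s := by
      push_cast
      rw [hs]
      ring
    have h2 : 0 < 1 - s := by nlinarith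
    have h3 : Real.exp s ≤ (1 - s)⁻¹ := by
      rw [le_inv_comm₀ (Real.exp_pos s) h2, ← Real.exp_neg]
      exact Real.one_sub_le_exp_neg s
    rw [h1]
    refine h3.trans_lt ?_
    rw [inv_lt_iff_one_lt_mul₀ h2, hs]
    nlinarith [mul_pos hε hε, mul_pos (mul_pos hε hε) hε]
  refine squeeze_zero (fun _ => measureReal_nonneg) (fun N => ?_)
    (tendsto_pow_atTop_nhds_zero_of_lt_one (by positivity) hb)
  refine (stdGaussian_norm_sq_le (t := -(ε / 4)) (by linarith) _).trans_eq ?_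
  rw [finrank_euclideanSpace_fin, mul_pow, ← Real.exp_nat_mul]
  congr 2
  · ring_nf
  · ring_nf

lemma tendsto_stdGaussian_exists_card_le {p : ℕ → ℕ} (hp : Tendsto p atTop atTop)
    (hlog : Tendsto (fun N : ℕ => Real.log (p N) / N) atTop (𝓝 0))
    (W : ∀ N, Finset ℕ → Submodule ℝ (EuclideanSpace ℝ (Fin N)))
    (hW : ∀ N J, Module.finrank ℝ (W N J) ≤ J.card) (m : ℕ) {ε : ℝ} (hε : 0 < ε) :
    Tendsto (fun N : ℕ => (stdGaussian (EuclideanSpace ℝ (Fin N))).real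
      {z | ∃ J ⊆ Finset.range (p N), J.card ≤ m ∧ ε * N ≤ ‖(W N J).starProjection z‖ ^ 2})
      atTop (𝓝 0) := by
  set C := (√(1 - 2 * (1 / 4 : ℝ)))⁻¹ ^ m
  have h1 : Tendsto (fun N : ℕ => Real.exp (N * (-(ε / 4) + m * (Real.log (p N) / N))))
      atTop (𝓝 0) := by
    refine Real.tendsto_exp_atBot.comp ?_
    refine tendsto_natCast_atTop_atTop.atTop_mul_neg (C := -(ε / 4)) (by linarith) ?_
    simpa using (hlog.const_mul (m : ℝ)).const_add (-(ε / 4))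
  have h2 := (h1.const_mul C).mul_const (Real.exp 1)
  rw [mul_zero, zero_mul] at h2
  refine squeeze_zero' (Eventually.of_forall fun _ => measureReal_nonneg) ?_ h2
  filter_upwards [hp.eventually_gt_atTop 0, eventually_gt_atTop 0] with N hpN hN
  refine (stdGaussian_exists_card_le (W N) (hW N) hpN m (t := 1 / 4) (by norm_num) (by norm_num)
    _).trans_eq ?_
  have hpN' : (0 : ℝ) < p N := by exact_mod_cast hpN
  have hN' : (N : ℝ) ≠ 0 := by positivity
  have h3 : (N : ℝ) * (-(ε / 4) + m * (Real.log (p N) / N))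
      = -(1 / 4) * (ε * N) + m * Real.log (p N) := by
    field_simp
  rw [h3, Real.exp_add, Real.exp_nat_mul, Real.exp_log hpN']
  ring

/-- The projections of the noise to the extra dimensions of the overfitting models: a chi-square
variable with `k` degrees of freedom exceeds `2 α k ln p` with probability about `p ^ (-α k)`,
and there are at most `p ^ k` choices of `k` superfluous covariates. -/
lemma tendsto_stdGaussian_exists_nonempty {p : ℕ → ℕ} (hp : Tendsto p atTop atTop)
    (W : ∀ N, Finset ℕ → Submodule ℝ (EuclideanSpace ℝ (Fin N)))
    (hW : ∀ N T, Module.finrank ℝ (W N T) ≤ T.card) {α : ℝ} (hα : 1 < α) :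
    Tendsto (fun N : ℕ => (stdGaussian (EuclideanSpace ℝ (Fin N))).real
      {z | ∃ T ⊆ Finset.range (p N), T.Nonempty ∧
        2 * α * Real.log (p N) * T.card ≤ ‖(W N T).starProjection z‖ ^ 2}) atTop (𝓝 0) := by
  have hα0 : 0 < α := by linarith
  -- the Chernoff exponent `t` satisfies `1 / (2 α) < t < 1 / 2`
  set t := (1 + α) / (4 * α) with ht
  have ht1 : 2 * t * α = (1 + α) / 2 := by
    rw [ht]
    field_simp
    ring
  have ht0 : 0 ≤ t := by positivity
  have ht2 : t < 1 / 2 := by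
    rw [ht, div_lt_div_iff₀ (by positivity) two_pos]
    linarith
  set C := (√(1 - 2 * t))⁻¹
  have hlogp : Tendsto (fun N => Real.log (p N)) atTop atTop :=
    Real.tendsto_log_atTop.comp (tendsto_natCast_atTop_atTop.comp hp)
  have h1 : Tendsto (fun N => Real.exp ((1 - α) / 2 * Real.log (p N))) atTop (𝓝 0) :=
    Real.tendsto_exp_atBot.comp (hlogp.const_mul_atTop_of_neg (by linarith))
  have h2 := ((Real.continuous_exp.tendsto _).comp (h1.mul_const C)).sub_const 1
  rw [zero_mul, Real.exp_zero, sub_self] at h2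
  refine squeeze_zero' (Eventually.of_forall fun _ => measureReal_nonneg) ?_ h2
  filter_upwards [hp.eventually_gt_atTop 0] with N hpN
  refine (stdGaussian_exists_nonempty_le (W N) (hW N) (p N) ht0 ht2 _).trans_eq ?_
  have hpN' : (0 : ℝ) < p N := by exact_mod_cast hpN
  have h3 : (1 - α) / 2 * Real.log (p N)
      = Real.log (p N) + -t * (2 * α * Real.log (p N)) := by
    linear_combination Real.log (p N) * ht1
  simp only [Function.comp_apply]
  rw [h3, Real.exp_add, Real.exp_log hpN', mul_assoc (p N : ℝ)]

/-! ### Consistency -/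

/-- When the coefficients do not vanish, the noise variance is bounded; it even converges, because
`‖A x‖² / N` does and the signal-to-noise ratio has a nonzero limit. -/
lemma exists_eventually_variance_le {x : ℕ →₀ ℝ} {K : ℕ} {p : ℕ → ℕ}
    (hp : Tendsto p atTop atTop) (hK : x.support.card ≤ K) {A : ∀ N : ℕ, Matrix (Fin N) ℕ ℝ}
    (hA : SparseRiesz K p A) {v : ℕ → ℝ≥0} {ρ : ℝ} (hρ : 0 < ρ)
    (hsnr : Tendsto (fun N : ℕ => snr (p N) (A N) x (v N)) atTop (𝓝 ρ)) :
    ∃ V : ℝ, 0 < V ∧ ∀ᶠ N in atTop, (v N : ℝ) ≤ V := by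
  obtain ⟨M, -, hM⟩ := hA.1 x.support (by omega)
  set w : x.support → ℝ := fun j => x j
  have h1 : Tendsto (fun N : ℕ => signal (p N) (A N) x ⬝ᵥ signal (p N) (A N) x / N) atTop
      (𝓝 (w ⬝ᵥ (M *ᵥ w))) := by
    have hcont : Continuous fun G : Matrix x.support x.support ℝ => w ⬝ᵥ (G *ᵥ w) := by fun_prop
    refine ((hcont.tendsto M).comp hM).congr' ?_
    filter_upwards [hp.eventually_ge_atTop (x.support.sup id + 1)] with N hN
    have hx : x.support ⊆ Finset.range (p N) := fun j hj =>
      Finset.mem_range.2 (by have := Finset.le_sup (f := id) hj; simp only [id] at this; omega)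
    rw [← norm_sq_toLp, toLp_signal_eq hx, norm_sq_toLp_cols_mulVec]
    simp only [Function.comp_apply, Matrix.smul_mulVec, dotProduct_smul, smul_eq_mul]
    rw [inv_mul_eq_div]
  have h2 : Tendsto (fun N : ℕ => (v N : ℝ)) atTop (𝓝 (w ⬝ᵥ (M *ᵥ w) / ρ)) := by
    refine (h1.div hsnr hρ.ne').congr' ?_
    filter_upwards [hsnr.eventually_const_lt hρ] with N hN
    simp only [snr] at hN ⊢
    have h3 : signal (p N) (A N) x ⬝ᵥ signal (p N) (A N) x / N ≠ 0 := by
      intro h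
      rw [h, zero_div] at hN
      exact lt_irrefl _ hN
    exact div_div_cancel₀ h3
  refine ⟨max (w ⬝ᵥ (M *ᵥ w) / ρ + 1) 1, by positivity, ?_⟩
  filter_upwards [h2.eventually_lt_const (lt_add_one _)] with N hN
  exact hN.le.trans (le_max_left _ _)

end EBICR

theorem theorem2
    -- `p = N ^ d` covariates, rounded (up or down) to an integer
    (d : ℝ) (hd : 0 < d)
    (p : ℕ → ℕ) (hp : ∀ N : ℕ, |(p N : ℝ) - (N : ℝ) ^ d| < 1)
    -- the coefficients; the true model `S = {j : x j ≠ 0}` has `k₀ = card S ≤ K` elements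
    (x : ℕ →₀ ℝ) (K : ℕ) (hK : x.support.card ≤ K)
    -- the designs
    (A : ∀ N : ℕ, Matrix (Fin N) ℕ ℝ) (hA : EBICR.SparseRiesz K p A)
    -- the noise variances `σ²`; the signal-to-noise ratio is fixed or at least tends to a limit,
    -- which is positive (and which exists whenever `σ²` does not depend on `N`)
    (v : ℕ → ℝ≥0) (hv : ∀ N, 0 < v N)
    (ρ : ℝ) (hρ : x ≠ 0 → 0 < ρ)
    (hsnr : Tendsto (fun N : ℕ => EBICR.snr (p N) (A N) x (v N)) atTop (𝓝 ρ))
    -- the tuning parameter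
    (ζ : ℝ) (hζ : 1 - 1 / (2 * d) < ζ) :
    Tendsto (fun N : ℕ => EBICR.noiseLaw N (v N)
      (EBICR.selectsTrue ζ K (p N) (A N) x x.support)) atTop (𝓝 1) := by
  open EBICR in
  have hpt : Tendsto p atTop atTop := tendsto_card_covariates hd hp
  obtain ⟨c, hc, hcA⟩ := hA.2
  -- `g` is the guaranteed relative increase of the residual variance in an underfitting model
  obtain ⟨g, hg, hgx⟩ : ∃ g : ℝ, 0 < g ∧
      ∀ᶠ N in atTop, ∀ j ∈ x.support, 16 * g * v N ≤ c * x j ^ 2 := by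
    rcases eq_or_ne x 0 with rfl | hx0
    · exact ⟨1, one_pos, by simp⟩
    · obtain ⟨V, hV, hvV⟩ := exists_eventually_variance_le hpt hK hA (hρ hx0) hsnr
      obtain ⟨i, hi, hmin⟩ := Finset.exists_min_image x.support (fun j => x j ^ 2)
        (Finsupp.support_nonempty_iff.2 hx0)
      have hxi : 0 < x i ^ 2 := by
        have := Finsupp.mem_support_iff.1 hi
        positivity
      refine ⟨c * x i ^ 2 / (16 * V), by positivity, ?_⟩
      filter_upwards [hvV] with N hN j hj
      calc 16 * (c * x i ^ 2 / (16 * V)) * v N ≤ 16 * (c * x i ^ 2 / (16 * V)) * V := by gcongr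
        _ = c * x i ^ 2 := by field_simp
        _ ≤ c * x j ^ 2 := by gcongr 1; exact hmin j hj
  -- `α > 1` is the slack that the strict inequality for `ζ` leaves
  obtain ⟨α, hα, hαd⟩ : ∃ α : ℝ, 1 < α ∧ 2 * α ^ 2 * d < 1 + 2 * ζ * d := by
    have h1 : 2 * d < 1 + 2 * ζ * d := by
      have h2 := mul_lt_mul_of_pos_right hζ (mul_pos two_pos hd)
      rw [sub_mul, one_div, inv_mul_cancel₀ (by positivity)] at h2
      linarith
    have h3 : Tendsto (fun α : ℝ => 2 * α ^ 2 * d) (𝓝[>] 1) (𝓝 (2 * 1 ^ 2 * d)) :=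
      ((by fun_prop : Continuous fun α : ℝ => 2 * α ^ 2 * d).tendsto 1).mono_left
        nhdsWithin_le_nhds
    have h4 := h3.eventually_lt_const (by linarith : 2 * 1 ^ 2 * d < 1 + 2 * ζ * d)
    obtain ⟨α, h5, h6⟩ := (h4.and self_mem_nhdsWithin).exists
    exact ⟨α, h6, h5⟩
  have hα0 : 0 < α := by linarith
  obtain ⟨ε, hε, hεα, hεg⟩ : ∃ ε : ℝ, 0 < ε ∧ 1 ≤ α * (1 - 2 * ε) ∧ 3 * ε ≤ 4 * g := by
    refine ⟨min ((α - 1) / (2 * α)) (4 * g / 3), ?_, ?_, ?_⟩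
    · have : 0 < α - 1 := by linarith
      positivity
    · have h1 : 2 * α * min ((α - 1) / (2 * α)) (4 * g / 3) ≤ 2 * α * ((α - 1) / (2 * α)) :=
        mul_le_mul_of_nonneg_left (min_le_left _ _) (by positivity)
      rw [mul_div_cancel₀ _ (by positivity)] at h1
      linarith
    · linarith [min_le_right ((α - 1) / (2 * α)) (4 * g / 3)]
  have hε2 : 2 * ε < 1 := by
    by_contra! h
    nlinarith
  -- the four exceptional events
  let W : ∀ N, Finset ℕ → Submodule ℝ (EuclideanSpace ℝ (Fin N)) := fun N T =>
    (colSpan (A N) x.support)ᗮ ⊓ colSpan (A N) (x.support ∪ T)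
  have hW : ∀ N T, Module.finrank ℝ (W N T) ≤ T.card := fun N T =>
    (finrank_orthogonal_inf_colSpan_le Finset.subset_union_left).trans
      (Finset.card_le_card (by rw [Finset.union_sdiff_left]; exact Finset.sdiff_subset))
  let B₁ : ∀ N, Set (EuclideanSpace ℝ (Fin N)) := fun N => {z | ‖z‖ ^ 2 ≤ (1 - ε) * N}
  let B₂ : ∀ N, Set (EuclideanSpace ℝ (Fin N)) := fun N => {z | 4 * N ≤ ‖z‖ ^ 2}
  let B₃ : ∀ N, Set (EuclideanSpace ℝ (Fin N)) := fun N => {z | ∃ J ⊆ Finset.range (p N),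
    J.card ≤ 2 * K ∧ ε * N ≤ ‖(colSpan (A N) J).starProjection z‖ ^ 2}
  let B₄ : ∀ N, Set (EuclideanSpace ℝ (Fin N)) := fun N => {z | ∃ T ⊆ Finset.range (p N),
    T.Nonempty ∧ 2 * α * Real.log (p N) * T.card ≤ ‖(W N T).starProjection z‖ ^ 2}
  have hB : Tendsto (fun N : ℕ => (stdGaussian (EuclideanSpace ℝ (Fin N))).real
      (B₁ N ∪ B₂ N ∪ B₃ N ∪ B₄ N)) atTop (𝓝 0) := by
    have h := (((tendsto_stdGaussian_norm_sq_le hε (by linarith)).add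
      tendsto_stdGaussian_norm_sq_ge).add
      (tendsto_stdGaussian_exists_card_le hpt (tendsto_log_card_div hd hp)
        (fun N => colSpan (A N)) (fun N => finrank_colSpan_le (A N)) (2 * K) hε)).add
      (tendsto_stdGaussian_exists_nonempty hpt W hW hα)
    simp only [add_zero] at h
    refine squeeze_zero (fun _ => measureReal_nonneg) (fun N => ?_) h
    refine (measureReal_union_le _ _).trans (add_le_add_left ?_ _)
    refine (measureReal_union_le _ _).trans (add_le_add_left ?_ _)
    exact measureReal_union_le _ _
  -- outside of them the true model is selected
  have hgood : ∀ᶠ N : ℕ in atTop, ∀ z ∉ B₁ N ∪ B₂ N ∪ B₃ N ∪ B₄ N,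
      √(v N : ℝ) • WithLp.ofLp z ∈ selectsTrue ζ K (p N) (A N) x x.support := by
    filter_upwards [eventually_gt_atTop 0, hcA, hgx, hsnr.eventually_lt_const (lt_add_one ρ),
      hpt.eventually_ge_atTop (x.support.sup id + 1),
      eventually_penalty_gt hd hp hαd,
      eventually_penalty_lt hd hp ζ K ((K + 2) * Real.log ((2 * (ρ + 1) + 8) / (1 - 2 * ε)))
        (Real.log_pos (by linarith : 1 < 1 + g))] with N hN hAN hgN hsN hpN hover hunder z hz
    simp only [B₁, B₂, B₃, B₄, Set.mem_union, Set.mem_ofPred_eq, not_or, not_exists, not_and,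
      not_le] at hz
    obtain ⟨⟨⟨hz₁, hz₂⟩, hz₃⟩, hz₄⟩ := hz
    have hx : x.support ⊆ Finset.range (p N) := fun j hj =>
      Finset.mem_range.2 (by have := Finset.le_sup (f := id) hj; simp only [id] at this; omega)
    have hlog : 0 ≤ Real.log (p N) := Real.log_natCast_nonneg _
    refine mem_selectsTrue (a := 2 * α * Real.log (p N)) hN hx hK (hv N) hc hAN (by positivity) ?_
      hε2 hg hεg hgN hsN.le hz₁.le hz₂.le (fun J h1 h2 => (hz₃ J h1 h2).le) (fun I hI hSI => ?_)
      hover hunder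
    · have := mul_le_mul_of_nonneg_left hεα (by positivity : 0 ≤ 2 * α * Real.log (p N))
      linarith
    · have h := (hz₄ (I \ x.support) (Finset.sdiff_subset.trans hI)
        (Finset.sdiff_nonempty.2 hSI.not_subset)).le
      have hWI : W N (I \ x.support) = (colSpan (A N) x.support)ᗮ ⊓ colSpan (A N) I := by
        simp only [W]
        rw [Finset.union_sdiff_of_subset hSI.subset]
      simpa only [hWI] using h
  have hlim : Tendsto (fun N : ℕ => 1 - (stdGaussian (EuclideanSpace ℝ (Fin N)))
      (B₁ N ∪ B₂ N ∪ B₃ N ∪ B₄ N)) atTop (𝓝 1) := by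
    have h := ENNReal.tendsto_ofReal hB
    rw [ENNReal.ofReal_zero] at h
    simpa using ENNReal.Tendsto.sub (tendsto_const_nhds (x := 1)) h (Or.inl ENNReal.one_ne_top)
  refine tendsto_of_tendsto_of_tendsto_of_le_of_le' hlim tendsto_const_nhds ?_ ?_
  · filter_upwards [hgood] with N hN
    rw [tsub_le_iff_right, noiseLaw_eq_map]
    set f : EuclideanSpace ℝ (Fin N) → Fin N → ℝ := fun z => √(v N : ℝ) • WithLp.ofLp z with hf
    have hfm : Measurable f := by fun_prop
    set G := selectsTrue ζ K (p N) (A N) x x.support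
    calc (1 : ℝ≥0∞) = stdGaussian (EuclideanSpace ℝ (Fin N)) Set.univ := measure_univ.symm
      _ ≤ stdGaussian _ (f ⁻¹' G ∪ (B₁ N ∪ B₂ N ∪ B₃ N ∪ B₄ N)) :=
        measure_mono fun z _ => (em (z ∈ B₁ N ∪ B₂ N ∪ B₃ N ∪ B₄ N)).elim Or.inr
          fun hz => Or.inl (hN z hz)
      _ ≤ stdGaussian _ (f ⁻¹' G) + stdGaussian _ (B₁ N ∪ B₂ N ∪ B₃ N ∪ B₄ N) :=
        measure_union_le _ _
      _ ≤ _ := by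
        gcongr
        exact Measure.le_map_apply hfm.aemeasurable G
  · refine Eventually.of_forall fun N => ?_
    have : IsProbabilityMeasure (noiseLaw N (v N)) := by
      unfold noiseLaw
      infer_instance
    exact prob_le_one
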